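/- A \emph{locale} is a complete lattice in which finite meets distribute over arbitrary joins; a morphism of locales (localic map) $f: L\to M$ is a meet-preserving map whose left adjoint $f^*: M\to L$ preserves finite meets. It is \emph{closed} if $f(\uparrow a)=\ \uparrow f(a)$ for all $a\in L$. A locale $L$ is \emph{strongly Hausdorff} if its diagonal $L\to L\times L$ (product in the category $\mathsf{Loc}$ of locales) is closed, and \emph{compact} if every $A\subseteq L$ with $\bigvee A=1$ has a finite subset with join $1$. Let $\mathsf{HLoc}$ be the full subcategory of $\mathsf{Loc}$ of strongly Hausdorff locales, and $J:\mathsf{KHLoc}\to\mathsf{HLoc}$ the inclusion of the full subcategory of compact strongly Hausdorff locales. For $L\in\mathsf{HLoc}$ let $J_L:\mathsf{KHLoc}/L\to\mathsf{HLoc}$, $(\sigma:K\to L)\mapsto K$. The \emph{density comonad} of a functor $F$ which has a pointwise left Kan extension $(T,\eta)$ along itself is $(T,\varepsilon,\delta)$, where $\varepsilon$ and $\delta$ are the unique natural transformations with $\varepsilon F\circ\eta=1_F$ and $\delta F\circ\eta=T\eta\circ\eta$. \textbf{Proposition.} \begin{enumerate} \item The functor $J$ has a pointwise left Kan extension along itself,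 and its density comonad $(T,\varepsilon,\delta)$ is idempotent ($\delta$ is an isomorphism). Let $\mathsf{kHLoc}$ be the category of $T$-coalgebras; a strongly Hausdorff locale is called \emph{compactly generated} if it is the underlying object of a $T$-coalgebra. \item The forgetful functor $U:\mathsf{kHLoc}\to\mathsf{HLoc}$ is fully faithful and injective on objects, and $\mathsf{kHLoc}$, viewed in this way as a full subcategory of $\mathsf{HLoc}$, is coreflective. There are a right adjoint $k$ of $U$ and a natural isomorphism $Uk\cong T$ under which the counit of the adjunction $U\dashv k$ corresponds to $\varepsilon$. For every $L\in\mathsf{HLoc}$ the diagram $J_L$ has a colimit, and $k(L)\cong\operatorname{colim}J_L$ by an isomorphism under which the counit $k(L)\to L$ corresponds to the map $\operatorname{colim}J_L\to L$ induced by the arrows $\sigma:K\to L$. \item A strongly Hausdorff locale $L$ is compactly generated if and only if there are a small category $\mathcal{J}$ and a functor $F:\mathcal{J}\to\mathsf{KHLoc}$ such that $JF$ has a colimit in $\mathsf{HLoc}$ and $L\cong\operatorname{colim}JF$. The ``if'' part holds for categories $\mathcal{J}$ of any size. \end{enumerate} -/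

import Mathlib

open CategoryTheory CategoryTheory.Limits

universe u v w

noncomputable section

/-! ## Density comonads and left Kan-extendable functors -/

section Density

universe v₁ v₂ u₁ u₂

/-- The density comonad of a functor `F : A ⥤ B`, attached to a left Kan extension `(T, η)` of `F`
along itself: the counit `ε` is the unique transformation with `ε F ∘ η = 1_F`, and the
comultiplication `δ` is the unique transformation with `δ F ∘ η = T η ∘ η`. -/
def densityComonadOf {A : Type u₁} [Category.{v₁} A] {B : Type u₂} [Category.{v₂} B]
    (F : A ⥤ B) (T : B ⥤ B) (η : F ⟶ F ⋙ T) [T.IsLeftKanExtension η] : Comonad B where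
  toFunctor := T
  ε := T.descOfIsLeftKanExtension η (𝟭 B) F.rightUnitor.inv
  δ := T.descOfIsLeftKanExtension η (T ⋙ T) (η ≫ Functor.whiskerRight η T)
  coassoc X := by
    have h : T.descOfIsLeftKanExtension η (T ⋙ T) (η ≫ Functor.whiskerRight η T) ≫
          Functor.whiskerRight
            (T.descOfIsLeftKanExtension η (T ⋙ T) (η ≫ Functor.whiskerRight η T)) T =
        T.descOfIsLeftKanExtension η (T ⋙ T) (η ≫ Functor.whiskerRight η T) ≫
          Functor.whiskerLeft T
            (T.descOfIsLeftKanExtension η (T ⋙ T) (η ≫ Functor.whiskerRight η T)) := by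
      apply T.hom_ext_of_isLeftKanExtension η
      ext a
      simp [← Functor.map_comp]
    exact NatTrans.congr_app h X
  left_counit X := by
    have h : T.descOfIsLeftKanExtension η (T ⋙ T) (η ≫ Functor.whiskerRight η T) ≫
          Functor.whiskerLeft T (T.descOfIsLeftKanExtension η (𝟭 B) F.rightUnitor.inv) =
        𝟙 T := by
      apply T.hom_ext_of_isLeftKanExtension η
      ext a
      simp
    exact NatTrans.congr_app h X
  right_counit X := by
    have h : T.descOfIsLeftKanExtension η (T ⋙ T) (η ≫ Functor.whiskerRight η T) ≫
          Functor.whiskerRight (T.descOfIsLeftKanExtension η (𝟭 B) F.rightUnitor.inv) T =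
        𝟙 T := by
      apply T.hom_ext_of_isLeftKanExtension η
      ext a
      simp [← Functor.map_comp]
    exact NatTrans.congr_app h X

/-- The density comonad of a functor which has a pointwise left Kan extension along itself;
its value at `X` is the colimit of `F ↓ X ⥤ A ⥤ B`. -/
def densityComonad {A : Type u₁} [Category.{v₁} A] {B : Type u₂} [Category.{v₂} B]
    (F : A ⥤ B) [F.HasPointwiseLeftKanExtension F] : Comonad B :=
  densityComonadOf F (F.pointwiseLeftKanExtension F) (F.pointwiseLeftKanExtensionUnit F)

/-- A functor (in practice, the inclusion of a subcategory) is left Kan-extendable if it has a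
pointwise left Kan extension along itself and its density comonad is idempotent. -/
class IsLeftKanExtendable {A : Type u₁} [Category.{v₁} A] {B : Type u₂} [Category.{v₂} B]
    (F : A ⥤ B) : Prop where
  hasPointwise : F.HasPointwiseLeftKanExtension F
  idempotent : IsIso (densityComonad F).δ

instance {A : Type u₁} [Category.{v₁} A] {B : Type u₂} [Category.{v₂} B]
    (F : A ⥤ B) [h : IsLeftKanExtendable F] : F.HasPointwiseLeftKanExtension F :=
  h.hasPointwise

end Density

/-! ## Locales -/


/-- The localic map `f_* : X → Y` of a morphism of locales `f : X ⟶ Y`, that is, the right adjoint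
of the frame homomorphism `f^* : Y → X`. -/
def Locale.localicMap {X Y : Locale.{u}} (f : X ⟶ Y) (x : X) : Y :=
  sSup {y : Y | (Quiver.Hom.unop f).hom y ≤ x}

/-- A morphism of locales is closed if the image of each closed sublocale `↑a` is the closed
sublocale `↑(f_* a)`. -/
def Locale.IsClosedHom {X Y : Locale.{u}} (f : X ⟶ Y) : Prop :=
  ∀ a : X, Locale.localicMap f '' Set.Ici a = Set.Ici (Locale.localicMap f a)

/-- A locale is strongly Hausdorff if its diagonal `L ⟶ L × L` into the product in the category of
locales is closed. (The choice of product is immaterial.) -/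
def Locale.IsStronglyHausdorff (L : Locale.{u}) : Prop :=
  ∃ (P : BinaryFan L L) (hP : IsLimit P),
    Locale.IsClosedHom (hP.lift (BinaryFan.mk (𝟙 L) (𝟙 L)))

/-- A locale is compact if each of its covers has a finite subcover. -/
def Locale.IsCompact (L : Locale.{u}) : Prop :=
  ∀ A : Set L, sSup A = ⊤ → ∃ F ⊆ A, F.Finite ∧ sSup F = ⊤

/-- The category of strongly Hausdorff locales, a full subcategory of the category of locales. -/
abbrev HLoc : Type (u + 1) :=
  ObjectProperty.FullSubcategory (fun L : Locale.{u} => L.IsStronglyHausdorff)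

/-- The category of compact strongly Hausdorff locales, a full subcategory of `HLoc`. -/
abbrev KHLoc : Type (u + 1) :=
  ObjectProperty.FullSubcategory (fun L : HLoc.{u} => L.obj.IsCompact)

/-- The inclusion `J : KHLoc ⥤ HLoc`. -/
abbrev KHLoc.incl : KHLoc.{u} ⥤ HLoc.{u} :=
  ObjectProperty.ι (fun L : HLoc.{u} => L.obj.IsCompact)

/-- The diagram `J_L : KHLoc / L ⥤ HLoc`, sending `σ : K ⟶ L` to `K`. -/
abbrev KHLoc.over (L : HLoc.{u}) : CostructuredArrow KHLoc.incl L ⥤ HLoc.{u} :=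
  CostructuredArrow.proj KHLoc.incl L ⋙ KHLoc.incl

/-- The category of compactly generated strongly Hausdorff locales: the category of coalgebras over
the density comonad of `J : KHLoc ⥤ HLoc`. -/
abbrev kHLoc [IsLeftKanExtendable KHLoc.incl.{u}] : Type (u + 1) :=
  (densityComonad KHLoc.incl.{u}).Coalgebra

/-- The forgetful functor `kHLoc ⥤ HLoc`. -/
abbrev kHLoc.incl [IsLeftKanExtendable KHLoc.incl.{u}] : kHLoc.{u} ⥤ HLoc.{u} :=
  (densityComonad KHLoc.incl.{u}).forget

/-- A strongly Hausdorff locale is compactly generated if it is an object of `kHLoc`. -/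
def HLoc.IsCompactlyGenerated [IsLeftKanExtendable KHLoc.incl.{u}] (L : HLoc.{u}) : Prop :=
  ∃ A : kHLoc.{u}, kHLoc.incl.obj A = L

end

/-! The formal half rests on one property, `CounitSeparates`: two maps from a compact `K` to `T L`
agree once their composites with the counit `T L ⟶ L` agree. Every such map is then a coprojection
`leg`, so the comultiplication inverts the counit at `T L`. Any section of a counit is its inverse
and a coalgebra structure, so being a coalgebra is a property of the object and every map between
coalgebras respects the structure. On a colimit of compact objects, such a section is glued from
coprojections.

The localic half replaces the closed diagonal by `DisjointSeparated`, a condition on pairs of frame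
homomorphisms that mentions no product. It passes to sublocales and to subframes generated by
families of subframes. Hence the largest such subframe of a limit of frames gives the colimit in
`HLoc`. Each map from a compact locale to `L` factors through its image, a compact sublocale of `L`;
up to isomorphism these form a small final family, so `T L` exists although `KHLoc / L` is large.

For `CounitSeparates`, compact strongly Hausdorff locales are regular, hence spatial, so `K` may be
taken to be a point. The points of `L` jointly cover `T L`, since every coprojection factors through
the sublocale they span. Given a point `p` of `T L`, the largest open missing `p` therefore misses
the coprojection of some point of `L`; disjointness separation, acting as a T₁ axiom, identifies the
two. -/

noncomputable section

/-! ### Density comonads whose counit separates maps from the generating objects -/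

section DensityComonad

universe v₁ v₂ u₁ u₂

namespace densityComonad

variable {A : Type u₁} [Category.{v₁} A] {B : Type u₂} [Category.{v₂} B]
  (F : A ⥤ B) [F.HasPointwiseLeftKanExtension F]

/-- The coprojection `F a ⟶ T X` of the colimit `T X` at the index `σ : F a ⟶ X`. -/
def leg {a : A} {X : B} (σ : F.obj a ⟶ X) : F.obj a ⟶ (densityComonad F).obj X :=
  colimit.ι (CostructuredArrow.proj F X ⋙ F) (CostructuredArrow.mk σ)

/-- The counit `T X ⟶ X`. -/
def counit (X : B) : (densityComonad F).obj X ⟶ X :=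
  (densityComonad F).ε.app X

/-- The comultiplication `T X ⟶ T (T X)`. -/
def comul (X : B) : (densityComonad F).obj X ⟶ (densityComonad F).obj ((densityComonad F).obj X) :=
  (densityComonad F).δ.app X

variable {F}

lemma hom_ext {X Y : B} {f g : (densityComonad F).obj X ⟶ Y}
    (h : ∀ (a : A) (σ : F.obj a ⟶ X), leg F σ ≫ f = leg F σ ≫ g) : f = g :=
  colimit.hom_ext fun j => h j.left j.hom

/-- The map out of `T X` with given compatible components. -/
def desc {X Y : B} (l : ∀ (a : A), (F.obj a ⟶ X) → (F.obj a ⟶ Y))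
    (hl : ∀ (a b : A) (h : a ⟶ b) (σ : F.obj b ⟶ X), F.map h ≫ l b σ = l a (F.map h ≫ σ)) :
    (densityComonad F).obj X ⟶ Y :=
  colimit.desc (CostructuredArrow.proj F X ⋙ F)
    { pt := Y
      ι :=
        { app j := l j.left j.hom
          naturality i j f := by
            refine (hl _ _ f.left j.hom).trans ?_
            rw [CostructuredArrow.w f]
            exact (Category.comp_id _).symm } }

lemma leg_desc {X Y : B} (l : ∀ (a : A), (F.obj a ⟶ X) → (F.obj a ⟶ Y))
    (hl : ∀ (a b : A) (h : a ⟶ b) (σ : F.obj b ⟶ X), F.map h ≫ l b σ = l a (F.map h ≫ σ))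
    {a : A} (σ : F.obj a ⟶ X) : leg F σ ≫ desc l hl = l a σ :=
  colimit.ι_desc _ _

lemma map_leg {a b : A} {X : B} (h : a ⟶ b) (σ : F.obj b ⟶ X) :
    F.map h ≫ leg F σ = leg F (F.map h ≫ σ) :=
  colimit.w (CostructuredArrow.proj F X ⋙ F)
    (CostructuredArrow.homMk h : CostructuredArrow.mk (F.map h ≫ σ) ⟶ CostructuredArrow.mk σ)

lemma leg_map {a : A} {X Y : B} (σ : F.obj a ⟶ X) (f : X ⟶ Y) :
    leg F σ ≫ (densityComonad F).map f = leg F (σ ≫ f) := by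
  change colimit.ι _ _ ≫ (F.pointwiseLeftKanExtension F).map f = _
  simp [leg, Functor.pointwiseLeftKanExtension, CostructuredArrow.map_mk]
  rfl

lemma leg_counit {a : A} {X : B} (σ : F.obj a ⟶ X) : leg F σ ≫ counit F X = σ := by
  have h := Functor.pointwiseLeftKanExtension_desc_app F F (𝟭 B) F.rightUnitor.inv X
  refine (congrArg (leg F σ ≫ ·) h).trans ?_
  refine (colimit.ι_desc _ _).trans ?_
  simp only [Functor.costructuredArrowMapCocone]
  exact Category.id_comp σ

lemma leg_comul {a : A} {X : B} (σ : F.obj a ⟶ X) :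
    leg F σ ≫ comul F X = leg F (leg F σ) := by
  have h := Functor.pointwiseLeftKanExtension_desc_app F F
    ((densityComonad F).toFunctor ⋙ (densityComonad F).toFunctor)
    (F.pointwiseLeftKanExtensionUnit F ≫
      Functor.whiskerRight (F.pointwiseLeftKanExtensionUnit F) (densityComonad F).toFunctor) X
  have h1 : leg F σ ≫ comul F X =
      (leg F (𝟙 (F.obj a)) ≫ (densityComonad F).map (leg F (𝟙 (F.obj a)))) ≫
        (densityComonad F).map ((densityComonad F).map σ) := by
    refine (congrArg (leg F σ ≫ ·) h).trans ?_
    refine (colimit.ι_desc _ _).trans ?_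
    rfl
  rw [h1, leg_map, Category.id_comp, leg_map, leg_map, Category.id_comp]

lemma map_counit {X Y : B} (f : X ⟶ Y) :
    (densityComonad F).map f ≫ counit F Y = counit F X ≫ f :=
  (densityComonad F).ε.naturality f

lemma comul_counit (X : B) :
    comul F X ≫ counit F ((densityComonad F).obj X) = 𝟙 _ :=
  (densityComonad F).left_counit X

lemma coalgebra_counit (X : (densityComonad F).Coalgebra) : X.a ≫ counit F X.A = 𝟙 X.A :=
  X.counit

variable (F) in
/-- Maps `F a ⟶ T X` are determined by their composites with the counit. -/
def CounitSeparates : Prop :=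
  ∀ ⦃a : A⦄ ⦃X : B⦄ (f g : F.obj a ⟶ (densityComonad F).obj X),
    f ≫ counit F X = g ≫ counit F X → f = g

/-- If maps out of `X` are determined by, and can be glued from, their composites with a cocone
over a diagram in `A`, then the counit at `X` has a section. -/
lemma exists_section_counit {J : Type*} [Category J] {G : J ⥤ A}
    {c : Cocone (G ⋙ F)} (hc : IsColimit c) : ∃ s, s ≫ counit F c.pt = 𝟙 c.pt := by
  -- The legs of the cocone, viewed as indices of the colimit `T c.pt`, give a cocone over the same
  -- diagram.
  let d : Cocone (G ⋙ F) :=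
    { pt := (densityComonad F).obj c.pt
      ι :=
        { app j := leg F (c.ι.app j)
          naturality i j f := by
            refine (map_leg (G.map f) (c.ι.app j)).trans ?_
            refine Eq.trans ?_ (Category.comp_id _).symm
            exact congrArg (leg F) (c.w f) } }
  refine ⟨hc.desc d, hc.hom_ext fun j => ?_⟩
  rw [hc.fac_assoc]
  exact (leg_counit _).trans (Category.comp_id _).symm

namespace CounitSeparates

variable (hF : CounitSeparates F)

include hF

lemma eq_leg {a : A} {X : B} (f : F.obj a ⟶ (densityComonad F).obj X) :
    f = leg F (f ≫ counit F X) :=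
  hF _ _ (leg_counit _).symm

/-- An index `f : F a ⟶ T X` of `T (T X)` is itself a coprojection, and the comultiplication sends
`leg σ` to `leg (leg σ)`. -/
lemma counit_comul (X : B) : counit F ((densityComonad F).obj X) ≫ comul F X = 𝟙 _ := by
  refine hom_ext fun a f => ?_
  rw [reassoc_of% (leg_counit f), Category.comp_id]
  conv_lhs => rw [hF.eq_leg f]
  rw [leg_comul, ← hF.eq_leg f]

lemma isIso_δ : IsIso (densityComonad F).δ := by
  have : ∀ X, IsIso ((densityComonad F).δ.app X) := fun X =>
    ⟨_, comul_counit X, hF.counit_comul X⟩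
  exact NatIso.isIso_of_isIso_app _

/-- A section of the counit is inverse to it. -/
lemma counit_section {X : B} {s : X ⟶ (densityComonad F).obj X}
    (hs : s ≫ counit F X = 𝟙 X) : counit F X ≫ s = 𝟙 _ := by
  refine hom_ext fun a σ => hF _ _ ?_
  rw [Category.comp_id, Category.assoc, Category.assoc, hs, Category.comp_id]

/-- A section of the counit is a coalgebra structure. -/
def coalgebra {X : B} {s : X ⟶ (densityComonad F).obj X}
    (hs : s ≫ counit F X = 𝟙 X) : (densityComonad F).Coalgebra where
  A := X
  a := s
  counit := hs
  coassoc := by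
    -- The counit at `T X` is monic, so coassociativity can be tested after it, where both sides
    -- reduce to `s`.
    have : Mono (counit F ((densityComonad F).obj X)) :=
      (show IsSplitMono _ from ⟨⟨⟨_, hF.counit_comul X⟩⟩⟩).mono
    refine (cancel_mono (counit F ((densityComonad F).obj X))).1 ?_
    refine Eq.trans (b := s) ?_ ?_
    · exact (Category.assoc _ _ _).trans
        ((congrArg (s ≫ ·) (comul_counit X)).trans (Category.comp_id s))
    · rw [Category.assoc, map_counit, hF.counit_section hs, Category.comp_id]

lemma isIso_counit (X : (densityComonad F).Coalgebra) : IsIso (counit F X.A) :=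
  ⟨X.a, hF.counit_section X.counit, X.counit⟩

/-- The counit at a coalgebra is invertible; cancelling it turns the coalgebra square into
naturality of the counit. -/
lemma full_forget : (densityComonad F).forget.Full where
  map_surjective {X Y} f := by
    let f' : X.A ⟶ Y.A := f
    refine ⟨⟨f', ?_⟩, rfl⟩
    have := hF.isIso_counit Y
    rw [← cancel_mono (counit F Y.A), Category.assoc, Category.assoc, map_counit,
      coalgebra_counit, reassoc_of% (coalgebra_counit X), Category.comp_id]

lemma forget_obj_injective : Function.Injective (densityComonad F).forget.obj := by
  rintro ⟨X, s, hs, hs'⟩ ⟨Y, t, ht, ht'⟩ (h : X = Y)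
  subst h
  have : s = t := by
    rw [← Category.comp_id s, ← hF.counit_section ht, ← Category.assoc]
    exact (congrArg (· ≫ t) hs).trans (Category.id_comp t)
  subst this
  rfl

end CounitSeparates

end densityComonad

end DensityComonad

/-! ### The coproduct of two frames -/

section FrameCoproduct

variable {L M Q : Type*} [Order.Frame L] [Order.Frame M] [Order.Frame Q]

lemma LowerSet.mem_himp_iff {α : Type*} [Preorder α] {V U : LowerSet α} {p : α} :
    p ∈ V ⇨ U ↔ ∀ q ≤ p, q ∈ V → q ∈ U := by
  rw [← LowerSet.Iic_le, le_himp_iff]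
  exact ⟨fun h q hq hV => h ⟨hq, hV⟩, fun h q hq => h q hq.1 hq.2⟩

lemma LowerSet.mk_mem {U : LowerSet (L × M)} {x x' : L} {y y' : M} (hx : x' ≤ x) (hy : y' ≤ y)
    (h : (x, y) ∈ U) : (x', y') ∈ U :=
  U.lower (Prod.mk_le_mk.2 ⟨hx, hy⟩) h

variable (L M) in
/-- The lower sets of `L × M` closed under joins in each variable, a sublocale of the frame of
all lower sets. It is the coproduct of the frames `L` and `M`. -/
def frameCoprod : Sublocale (LowerSet (L × M)) where
  carrier := {U | (∀ (S : Set L) (y : M), (∀ s ∈ S, (s, y) ∈ U) → (sSup S, y) ∈ U) ∧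
    ∀ (x : L) (S : Set M), (∀ s ∈ S, (x, s) ∈ U) → (x, sSup S) ∈ U}
  sInf_mem' 𝒰 h𝒰 := by
    simp only [Set.mem_ofPred_eq, LowerSet.mem_sInf_iff]
    exact ⟨fun S y h U hU => (h𝒰 hU).1 S y fun s hs => h s hs U hU,
      fun x S h U hU => (h𝒰 hU).2 x S fun s hs => h s hs U hU⟩
  himp_mem' V U hU := by
    simp only [Set.mem_ofPred_eq, LowerSet.mem_himp_iff]
    constructor
    · rintro S y h ⟨a, b⟩ hab hV
      -- Distributivity cuts the join down to `a`, so that each piece lies both below some `s` and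
      -- in `V`.
      have ha : a = sSup ((a ⊓ ·) '' S) := by
        rw [sSup_image, ← inf_sSup_eq, inf_eq_left.2 hab.1]
      rw [ha]
      refine hU.1 _ _ ?_
      rintro _ ⟨s, hs, rfl⟩
      exact h s hs (a ⊓ s, b) ⟨inf_le_right, hab.2⟩ (LowerSet.mk_mem inf_le_left le_rfl hV)
    · rintro x S h ⟨a, b⟩ hab hV
      have hb : b = sSup ((b ⊓ ·) '' S) := by
        rw [sSup_image, ← inf_sSup_eq, inf_eq_left.2 hab.2]
      rw [hb]
      refine hU.2 _ _ ?_
      rintro _ ⟨s, hs, rfl⟩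
      exact h s hs (a, b ⊓ s) ⟨hab.1, inf_le_right⟩ (LowerSet.mk_mem le_rfl inf_le_left hV)

namespace frameCoprod

/-- The rectangle `p.1 ⊗ p.2`. -/
def rect (p : L × M) : frameCoprod L M :=
  (frameCoprod L M).restrict (LowerSet.Iic p)

lemma rect_le_iff {p : L × M} {U : frameCoprod L M} : rect p ≤ U ↔ p ∈ U.1 :=
  ((frameCoprod L M).giRestrict.gc _ _).trans LowerSet.Iic_le

lemma mem_rect (p : L × M) : p ∈ (rect p).1 := rect_le_iff.1 le_rfl

lemma rect_inf_rect (p q : L × M) : rect p ⊓ rect q = rect (p ⊓ q) := by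
  rw [rect, rect, rect, LowerSet.Iic_inf, map_inf]

lemma le_of_forall_rect {U V : frameCoprod L M} (h : ∀ p, rect p ≤ U → rect p ≤ V) : U ≤ V :=
  fun p hp => rect_le_iff.1 (h p (rect_le_iff.2 hp))

variable (L M) in
/-- The first coprojection. -/
def inl : FrameHom L (frameCoprod L M) where
  toFun x := rect (x, ⊤)
  map_inf' x y := by rw [rect_inf_rect, Prod.mk_inf_mk, inf_top_eq]
  map_top' := top_unique (le_of_forall_rect fun p _ => rect_le_iff.2 <|
    (rect (⊤, ⊤)).1.lower le_top (mem_rect (⊤ : L × M)))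
  map_sSup' S := by
    refine eq_of_forall_ge_iff fun U => ?_
    simp only [sSup_image, iSup_le_iff, rect_le_iff]
    exact ⟨fun h s hs => LowerSet.mk_mem (le_sSup hs) le_rfl h, U.2.1 S ⊤⟩

variable (L M) in
/-- The second coprojection. -/
def inr : FrameHom M (frameCoprod L M) where
  toFun y := rect (⊤, y)
  map_inf' x y := by rw [rect_inf_rect, Prod.mk_inf_mk, inf_top_eq]
  map_top' := top_unique (le_of_forall_rect fun p _ => rect_le_iff.2 <|
    (rect (⊤, ⊤)).1.lower le_top (mem_rect (⊤ : L × M)))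
  map_sSup' S := by
    refine eq_of_forall_ge_iff fun U => ?_
    simp only [sSup_image, iSup_le_iff, rect_le_iff]
    exact ⟨fun h s hs => LowerSet.mk_mem le_rfl (le_sSup hs) h, U.2.2 ⊤ S⟩

lemma inl_le_iff {x : L} {U : frameCoprod L M} : inl L M x ≤ U ↔ (x, ⊤) ∈ U.1 := rect_le_iff

lemma inr_le_iff {y : M} {U : frameCoprod L M} : inr L M y ≤ U ↔ (⊤, y) ∈ U.1 := rect_le_iff

lemma inl_inf_inr (x : L) (y : M) : inl L M x ⊓ inr L M y = rect (x, y) :=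
  (rect_inf_rect _ _).trans (by rw [Prod.mk_inf_mk, inf_top_eq, top_inf_eq])

lemma eq_sSup_rect (U : frameCoprod L M) : U = sSup (rect '' {p | p ∈ U.1}) := by
  refine eq_of_forall_ge_iff fun V => ?_
  simp only [sSup_image, iSup_le_iff, rect_le_iff]
  rfl

lemma hom_ext {h k : FrameHom (frameCoprod L M) Q} (hl : ∀ x, h (inl L M x) = k (inl L M x))
    (hr : ∀ y, h (inr L M y) = k (inr L M y)) : h = k := by
  ext U
  rw [eq_sSup_rect U, map_sSup, map_sSup, ← Set.image_comp, ← Set.image_comp]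
  congr 1
  refine Set.image_congr fun p _ => ?_
  rw [Function.comp_apply, Function.comp_apply, ← inl_inf_inr, map_inf, map_inf, hl, hr]

section desc

variable (f : FrameHom L Q) (g : FrameHom M Q)

/-- The largest element of the coproduct that the copairing of `f` and `g` maps below `q`. -/
def descAdjoint (q : Q) : frameCoprod L M :=
  ⟨⟨{p | f p.1 ⊓ g p.2 ≤ q}, fun _ _ h hp =>
      (inf_le_inf (OrderHomClass.mono f h.1) (OrderHomClass.mono g h.2)).trans hp⟩, by
    constructor
    · intro S y h
      change f (sSup S) ⊓ g y ≤ q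
      rw [map_sSup, sSup_inf_eq]
      refine iSup₂_le ?_
      rintro _ ⟨s, hs, rfl⟩
      exact h s hs
    · intro x S h
      change f x ⊓ g (sSup S) ≤ q
      rw [map_sSup, inf_sSup_eq]
      refine iSup₂_le ?_
      rintro _ ⟨s, hs, rfl⟩
      exact h s hs⟩

/-- This adjunction is what makes the copairing preserve joins. -/
lemma desc_gc : GaloisConnection
    (fun U : frameCoprod L M => ⨆ p ∈ U.1, f p.1 ⊓ g p.2) (descAdjoint f g) := fun U q => by
  simp only [iSup_le_iff]
  rfl

/-- The copairing of two frame homomorphisms. -/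
def desc : FrameHom (frameCoprod L M) Q where
  toFun U := ⨆ p ∈ U.1, f p.1 ⊓ g p.2
  map_inf' U V := by
    refine le_antisymm ((desc_gc f g).monotone_l.map_inf_le U V) ?_
    simp only [iSup_inf_eq, inf_iSup_eq, iSup_le_iff]
    intro q hq p hp
    rw [inf_inf_inf_comm, ← map_inf, ← map_inf]
    exact le_iSup₂_of_le (p ⊓ q) ⟨U.1.lower inf_le_left hp, V.1.lower inf_le_right hq⟩ le_rfl
  map_top' := top_unique <| le_iSup₂_of_le ⊤ trivial (by simp)
  map_sSup' S := by
    rw [sSup_image]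
    exact (desc_gc f g).l_sSup

lemma desc_rect (p : L × M) : desc f g (rect p) = f p.1 ⊓ g p.2 :=
  le_antisymm ((desc_gc f g _ _).2 (rect_le_iff.2 (le_refl (f p.1 ⊓ g p.2))))
    (le_iSup₂_of_le p (mem_rect p) le_rfl)

@[simp]
lemma desc_inl (x : L) : desc f g (inl L M x) = f x :=
  (desc_rect f g _).trans (by simp)

@[simp]
lemma desc_inr (y : M) : desc f g (inr L M y) = g y :=
  (desc_rect f g _).trans (by simp)

end desc

end frameCoprod

end FrameCoproduct

/-! ## Strongly Hausdorff locales -/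

/-- A frame `L` is disjointness separated if two frame homomorphisms `f`, `g` from `L` are equal as
soon as `f x` and `g y` are disjoint for all disjoint `x` and `y`. -/
def DisjointSeparated (L : Type u) [Order.Frame L] : Prop :=
  ∀ (Q : Type u) [Order.Frame Q] (f g : FrameHom L Q),
    (∀ x y, x ⊓ y = ⊥ → f x ⊓ g y = ⊥) → f = g

namespace DisjointSeparated

variable {L : Type u} [Order.Frame L]

/-- Precomposing with `e` preserves the hypothesis on disjoint pairs. In localic terms, the
condition passes to sublocales. -/
lemma of_surjective {M : Type u} [Order.Frame M] (h : DisjointSeparated L) (e : FrameHom L M)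
    (he : Function.Surjective e) : DisjointSeparated M := fun Q _ f g hfg => by
  have := h Q (f.comp e) (g.comp e) fun x y hxy =>
    hfg _ _ ((map_inf e x y).symm.trans ((congrArg e hxy).trans (map_bot e)))
  ext x
  obtain ⟨x, rfl⟩ := he x
  exact DFunLike.congr_fun this x

/-- The largest element of the coproduct `L ⊗ L` which the codiagonal maps to `⊥`. -/
def codiagonalKernel (L : Type u) [Order.Frame L] : frameCoprod L L :=
  frameCoprod.descAdjoint (FrameHom.id L) (FrameHom.id L) ⊥

lemma mem_codiagonalKernel {x y : L} :
    (x, y) ∈ (codiagonalKernel L).1 ↔ x ⊓ y = ⊥ :=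
  le_bot_iff

/-- Joining with `d`, as a frame homomorphism to the frame of elements above `d`. -/
def supHom {P : Type u} [Order.Frame P] (d : P) :
    FrameHom P (Nucleus.toSublocale
      ({ toFun x := x ⊔ d
         map_inf' _ _ := sup_inf_right _ _ _
         idempotent' x := by rw [sup_assoc, sup_idem]
         le_apply' _ := le_sup_left } : Nucleus P)) :=
  Sublocale.restrict _

lemma supHom_apply {P : Type u} [Order.Frame P] (d x : P) : (supHom d x : P) = x ⊔ d := by
  rw [supHom, Nucleus.restrict_toSublocale]
  rfl

/-- Disjoint `x`, `y` have their rectangle in the kernel, so the two coprojections followed by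
restriction to the closed sublocale above it satisfy the separation hypothesis. -/
lemma sup_codiagonalKernel (h : DisjointSeparated L) (x : L) :
    frameCoprod.inl L L x ⊔ codiagonalKernel L = frameCoprod.inr L L x ⊔ codiagonalKernel L := by
  have := h _ ((supHom (codiagonalKernel L)).comp (frameCoprod.inl L L))
    ((supHom (codiagonalKernel L)).comp (frameCoprod.inr L L)) fun x y hxy => by
      rw [FrameHom.comp_apply, FrameHom.comp_apply, ← map_inf, frameCoprod.inl_inf_inr,
        ← le_bot_iff, ← map_bot (supHom (codiagonalKernel L)), ← Subtype.coe_le_coe,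
        supHom_apply, supHom_apply]
      exact sup_le (le_sup_of_le_right
        (frameCoprod.rect_le_iff.2 (mem_codiagonalKernel.2 hxy))) le_sup_right
  have := congrArg Subtype.val (DFunLike.congr_fun this x)
  rwa [FrameHom.comp_apply, FrameHom.comp_apply, supHom_apply, supHom_apply] at this

/-- The codiagonal of `L`. -/
def codiagonal (L : Type u) [Order.Frame L] : FrameHom (frameCoprod L L) L :=
  frameCoprod.desc (FrameHom.id L) (FrameHom.id L)

/-- Both coprojections agree on the closed sublocale above the kernel, so restriction to it factors
through the codiagonal. -/
lemma inl_codiagonal_sup (h : DisjointSeparated L) (p : frameCoprod L L) :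
    frameCoprod.inl L L (codiagonal L p) ⊔ codiagonalKernel L = p ⊔ codiagonalKernel L := by
  have : (supHom (codiagonalKernel L)).comp ((frameCoprod.inl L L).comp (codiagonal L)) =
      supHom (codiagonalKernel L) := by
    refine frameCoprod.hom_ext (fun x => ?_) fun x => Subtype.ext ?_
    · rw [FrameHom.comp_apply, FrameHom.comp_apply, codiagonal, frameCoprod.desc_inl]
      rfl
    · rw [FrameHom.comp_apply, FrameHom.comp_apply, codiagonal, frameCoprod.desc_inr,
        supHom_apply, supHom_apply]
      exact sup_codiagonalKernel h x
  have := congrArg Subtype.val (DFunLike.congr_fun this p)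
  rwa [FrameHom.comp_apply, FrameHom.comp_apply, supHom_apply, supHom_apply] at this

/-- A coproduct `P` of `L` with itself whose codiagonal has a closed kernel congruence makes `L`
disjointness separated. -/
lemma of_closed_codiagonal {P : Type u} [Order.Frame P] {i₁ i₂ : FrameHom L P}
    {Δ : FrameHom P L} (hΔ₁ : ∀ x, Δ (i₁ x) = x) (hΔ₂ : ∀ x, Δ (i₂ x) = x)
    (hsurj : Function.Surjective (frameCoprod.desc i₁ i₂)) {r : L → P}
    (gc : GaloisConnection Δ r) (hcl : r '' Set.Ici ⊥ = Set.Ici (r ⊥))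
    (hP : ∀ (Q : Type u) [Order.Frame Q] (f g : FrameHom L Q), ∃ k : FrameHom P Q,
      (∀ x, k (i₁ x) = f x) ∧ ∀ x, k (i₂ x) = g x) : DisjointSeparated L := by
  intro Q _ f g hfg
  obtain ⟨k, hk₁, hk₂⟩ := hP Q f g
  -- An element killed by `Δ` comes from a family of rectangles on disjoint pairs, which the
  -- hypothesis on `f` and `g` makes `k` kill.
  have hker : ∀ p, Δ p = ⊥ → k p = ⊥ := by
    intro p hp
    obtain ⟨U, rfl⟩ := hsurj p
    have h₁ : Δ.comp (frameCoprod.desc i₁ i₂) = codiagonal L :=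
      frameCoprod.hom_ext (fun x => by simp [hΔ₁, codiagonal]) (fun x => by simp [hΔ₂, codiagonal])
    have h₂ : k.comp (frameCoprod.desc i₁ i₂) = frameCoprod.desc f g :=
      frameCoprod.hom_ext (fun x => by simp [hk₁]) (fun x => by simp [hk₂])
    have h₃ : codiagonal L U = ⊥ := (DFunLike.congr_fun h₁ U).symm.trans hp
    refine (DFunLike.congr_fun h₂ U).trans ?_
    refine le_bot_iff.1 ((frameCoprod.desc_gc f g U ⊥).2 fun q hq => le_bot_iff.2 (hfg _ _ ?_))
    exact le_bot_iff.1 ((frameCoprod.desc_gc _ _ U ⊥).1 h₃.le hq)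
  have hd : k (r ⊥) = ⊥ := hker _ (le_bot_iff.1 (gc.l_u_le ⊥))
  -- By closedness `q ⊔ r ⊥` is a value of `r`, so whether `p` lies below it depends only on `Δ p`;
  -- and `k` ignores `r ⊥`.
  have key : ∀ p q, Δ p = Δ q → k p ≤ k q := by
    intro p q hpq
    have hq : q ⊔ r ⊥ ∈ r '' Set.Ici ⊥ := by
      rw [hcl]
      exact le_sup_right
    obtain ⟨a, -, ha⟩ := hq
    have hp : p ≤ q ⊔ r ⊥ := by
      rw [← ha, ← gc.le_iff_le, hpq, gc.le_iff_le, ha]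
      exact le_sup_left
    refine (OrderHomClass.mono k hp).trans ?_
    rw [map_sup, hd, sup_bot_eq]
  ext x
  rw [← hk₁, ← hk₂]
  exact le_antisymm (key _ _ ((hΔ₁ x).trans (hΔ₂ x).symm)) (key _ _ ((hΔ₂ x).trans (hΔ₁ x).symm))

end DisjointSeparated

namespace Locale

/-- The frame homomorphism `f^*` of a morphism of locales `f`. -/
def frameHom {X Y : Locale.{u}} (f : X ⟶ Y) : FrameHom Y X :=
  (Quiver.Hom.unop f).hom

/-- The morphism of locales of a frame homomorphism. -/
def homOf {X Y : Locale.{u}} (h : FrameHom Y X) : X ⟶ Y :=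
  Quiver.Hom.op (ConcreteCategory.ofHom (C := Frm.{u}) h)

@[simp]
lemma homOf_frameHom {X Y : Locale.{u}} (f : X ⟶ Y) : homOf (frameHom f) = f := rfl

lemma hom_ext_frameHom {X Y : Locale.{u}} {f g : X ⟶ Y} (h : frameHom f = frameHom g) : f = g := by
  rw [← homOf_frameHom f, h, homOf_frameHom]

lemma localicMap_gc {X Y : Locale.{u}} (f : X ⟶ Y) :
    GaloisConnection (frameHom f) (localicMap f) := fun y x =>
  ⟨fun h => le_sSup h, fun h => by
    refine (OrderHomClass.mono (frameHom f) h).trans ?_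
    rw [localicMap, map_sSup]
    refine sSup_le ?_
    rintro _ ⟨z, hz, rfl⟩
    exact hz⟩

/-- The frame coproduct of `L` with itself is the product of the locale `L` with itself. -/
def prodFan (L : Locale.{u}) : BinaryFan L L :=
  BinaryFan.mk (P := Locale.of (frameCoprod L L)) (homOf (frameCoprod.inl L L))
    (homOf (frameCoprod.inr L L))

/-- The universal property of the product. -/
def prodFanIsLimit (L : Locale.{u}) : IsLimit (prodFan L) :=
  BinaryFan.isLimitMk
    (fun s => homOf (frameCoprod.desc (frameHom s.fst) (frameHom s.snd)))
    (fun _ => hom_ext_frameHom (FrameHom.ext fun x => frameCoprod.desc_inl _ _ x))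
    (fun _ => hom_ext_frameHom (FrameHom.ext fun x => frameCoprod.desc_inr _ _ x))
    (fun _ _ hl hr => hom_ext_frameHom <| frameCoprod.hom_ext
      (fun x => (congrArg (frameHom · x) hl).trans (frameCoprod.desc_inl _ _ x).symm)
      (fun x => (congrArg (frameHom · x) hr).trans (frameCoprod.desc_inr _ _ x).symm))

lemma IsStronglyHausdorff.disjointSeparated {L : Locale.{u}} (h : L.IsStronglyHausdorff) :
    DisjointSeparated L := by
  obtain ⟨P, hP, hcl⟩ := h
  let Δ := hP.lift (BinaryFan.mk (𝟙 L) (𝟙 L))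
  let i₁ : FrameHom L P.pt := frameHom P.fst
  let i₂ : FrameHom L P.pt := frameHom P.snd
  -- The given product is compared with the concrete one, so that its opens too are joins of
  -- rectangles.
  have hsurj : Function.Surjective (frameCoprod.desc i₁ i₂) := by
    intro p
    let m : Locale.of (frameCoprod L L) ⟶ P.pt := hP.lift (prodFan L)
    let n : P.pt ⟶ Locale.of (frameCoprod L L) := homOf (frameCoprod.desc i₁ i₂)
    have hnm : n ≫ m = 𝟙 _ := BinaryFan.IsLimit.hom_ext hP
      (by
        have : m ≫ P.fst = homOf (frameCoprod.inl L L) := hP.fac (prodFan L) ⟨WalkingPair.left⟩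
        rw [Category.assoc, this, Category.id_comp]
        exact hom_ext_frameHom (FrameHom.ext fun x => frameCoprod.desc_inl _ _ x))
      (by
        have : m ≫ P.snd = homOf (frameCoprod.inr L L) := hP.fac (prodFan L) ⟨WalkingPair.right⟩
        rw [Category.assoc, this, Category.id_comp]
        exact hom_ext_frameHom (FrameHom.ext fun x => frameCoprod.desc_inr _ _ x))
    exact ⟨frameHom m p, congrArg (frameHom · p) hnm⟩
  refine DisjointSeparated.of_closed_codiagonal (Δ := frameHom Δ) (i₁ := i₁) (i₂ := i₂)
    (fun x => congrArg (frameHom · x) (hP.fac (BinaryFan.mk (𝟙 L) (𝟙 L)) ⟨WalkingPair.left⟩))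
    (fun x => congrArg (frameHom · x) (hP.fac (BinaryFan.mk (𝟙 L) (𝟙 L)) ⟨WalkingPair.right⟩))
    hsurj (localicMap_gc Δ) (hcl ⊥) fun Q _ f g => ?_
  let c : BinaryFan L L := BinaryFan.mk (P := Locale.of Q) (homOf f) (homOf g)
  exact ⟨frameHom (hP.lift c),
    fun x => congrArg (frameHom · x) (hP.fac c ⟨WalkingPair.left⟩),
    fun x => congrArg (frameHom · x) (hP.fac c ⟨WalkingPair.right⟩)⟩

lemma isStronglyHausdorff_of_disjointSeparated {L : Locale.{u}} (h : DisjointSeparated L) :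
    L.IsStronglyHausdorff := by
  refine ⟨prodFan L, prodFanIsLimit L, fun a => ?_⟩
  have hΔ : frameHom ((prodFanIsLimit L).lift (BinaryFan.mk (𝟙 L) (𝟙 L))) =
      DisjointSeparated.codiagonal L := rfl
  have gc := localicMap_gc ((prodFanIsLimit L).lift (BinaryFan.mk (𝟙 L) (𝟙 L)))
  rw [hΔ] at gc
  set r := localicMap ((prodFanIsLimit L).lift (BinaryFan.mk (𝟙 L) (𝟙 L)))
  have hr : DisjointSeparated.codiagonalKernel L ≤ r ⊥ :=
    (gc _ _).1 ((frameCoprod.desc_gc _ _ _ _).2 le_rfl)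
  refine Set.Subset.antisymm ?_ fun p (hp : r a ≤ p) =>
    ⟨DisjointSeparated.codiagonal L p, ?_, le_antisymm ?_ (gc.le_u_l p)⟩
  · rintro _ ⟨b, hb, rfl⟩
    exact gc.monotone_u hb
  · have : frameCoprod.inl L L a ≤ p :=
      ((gc _ _).1 (frameCoprod.desc_inl _ _ a).le).trans hp
    exact (frameCoprod.desc_inl (FrameHom.id L) (FrameHom.id L) a).symm.le.trans
      (OrderHomClass.mono (DisjointSeparated.codiagonal L) this)
  · have hdp : DisjointSeparated.codiagonalKernel L ≤ p :=
      hr.trans ((gc.monotone_u bot_le).trans hp)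
    refine le_sup_left.trans ((h.inl_codiagonal_sup _).symm.le.trans ?_)
    refine (sup_le_sup_right (OrderHomClass.mono (frameCoprod.inl L L) (gc.l_u_le _)) _).trans ?_
    exact (h.inl_codiagonal_sup p).le.trans (sup_eq_left.2 hdp).le

end Locale

/-! ## Compact strongly Hausdorff locales are spatial -/

/-- A frame is compact if each of its covers has a finite subcover. -/
def FrameCompact (L : Type u) [Order.Frame L] : Prop :=
  ∀ A : Set L, sSup A = ⊤ → ∃ F ⊆ A, F.Finite ∧ sSup F = ⊤

/-- The points of a locale. -/
abbrev FramePoint (L : Type u) [Order.Frame L] : Type u := FrameHom L (Set PUnit.{u + 1})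

/-- A frame is spatial if its elements are separated by points. -/
def FrameSpatial (L : Type u) [Order.Frame L] : Prop :=
  ∀ a b : L, (∀ p : FramePoint L, p a ≤ p b) → a ≤ b

section

variable {L : Type u} [Order.Frame L]

/-- The join of all elements rather below `c`. -/
def ratherInterior (c : L) : L :=
  sSup {z | ∃ w, z ⊓ w = ⊥ ∧ w ⊔ c = ⊤}

lemma le_ratherInterior {z w c : L} (h : z ⊓ w = ⊥) (hw : w ⊔ c = ⊤) : z ≤ ratherInterior c :=
  le_sSup ⟨w, h, hw⟩

/-- If `w'` witnesses that `z'` is rather below `w ⊔ c`, then `w' ⊔ w` witnesses that `z ⊓ z'` is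
rather below `c`. -/
lemma inf_ratherInterior_sup_le {z w c : L} (h : z ⊓ w = ⊥) :
    z ⊓ ratherInterior (w ⊔ c) ≤ ratherInterior c := by
  rw [ratherInterior, inf_sSup_eq]
  refine iSup₂_le ?_
  rintro z' ⟨w', hz', hw'⟩
  refine le_ratherInterior (w := w' ⊔ w) ?_ (by rw [sup_assoc, hw'])
  rw [inf_sup_left, inf_assoc, hz', inf_bot_eq, bot_sup_eq, inf_right_comm, h, bot_inf_eq]

/-- The pairs `(x, y)` such that `x` lies in the rather interior of every `c` which covers the
whole locale together with `y`. -/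
def ratherPairs (a : L) : Set (L × L) :=
  {p | ∀ c, a ≤ c → c ⊔ p.2 = ⊤ → p.1 ≤ ratherInterior c}

lemma mem_ratherPairs_sup {a x y y' : L} (h : (x, y) ∈ ratherPairs a)
    (h' : (x, y') ∈ ratherPairs a) : (x, y ⊔ y') ∈ ratherPairs a := by
  intro c hac hc
  have h₁ : x ≤ ratherInterior (c ⊔ y) := h' _ (hac.trans le_sup_left) ((sup_assoc _ _ _).trans hc)
  change x ≤ _
  rw [← inf_eq_left.2 h₁, ratherInterior, inf_sSup_eq]
  refine iSup₂_le ?_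
  rintro z ⟨w, hz, hw⟩
  have h₂ : x ≤ ratherInterior (w ⊔ c) :=
    h _ (hac.trans le_sup_right) ((sup_assoc _ _ _).trans hw)
  rw [inf_comm]
  exact (inf_le_inf_left z h₂).trans (inf_ratherInterior_sup_le hz)

lemma mem_ratherPairs_sSup_of_finite {a x : L} {S : Set L} (hS : S.Finite)
    (h : ∀ y ∈ S, (x, y) ∈ ratherPairs a) : (x, sSup S) ∈ ratherPairs a := by
  induction S, hS using Set.Finite.induction_on with
  | empty =>
    intro c _ hc
    refine le_ratherInterior (w := ⊥) (inf_bot_eq _) ?_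
    simpa using hc
  | @insert y S _ _ ih =>
    rw [sSup_insert]
    exact mem_ratherPairs_sup (h y (Set.mem_insert _ _))
      (ih fun y hy => h y (Set.mem_insert_of_mem _ hy))

/-- Compactness applied to the cover `insert c S` reduces to the finite case. -/
lemma mem_ratherPairs_sSup (hL : FrameCompact L) {a x : L} {S : Set L}
    (h : ∀ y ∈ S, (x, y) ∈ ratherPairs a) : (x, sSup S) ∈ ratherPairs a := by
  intro c hac hc
  obtain ⟨F, hF, hfin, hF'⟩ := hL (insert c S) (by rw [sSup_insert]; exact hc)
  have := mem_ratherPairs_sSup_of_finite (hfin.inter_of_left S) fun y hy => h y hy.2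
  refine this c hac (top_unique (hF'.ge.trans (sSup_le fun y hy => ?_)))
  obtain rfl | hyS := hF hy
  · exact le_sup_left
  · exact le_sup_of_le_right (le_sSup ⟨hy, hyS⟩)

/-- Compact strongly Hausdorff locales are regular. -/
lemma DisjointSeparated.le_ratherInterior (h : DisjointSeparated L) (hL : FrameCompact L) (a : L) :
    a ≤ ratherInterior a := by
  -- `U` contains the codiagonal kernel and `inr a`, hence also `inl a`; membership of `(a, ⊤)`,
  -- read at `c = a`, is regularity.
  let U : frameCoprod L L := ⟨⟨ratherPairs a, fun p q hqp hp c hac hc =>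
    hqp.1.trans (hp c hac (top_unique (hc.ge.trans (sup_le_sup_left hqp.2 _))))⟩,
    fun S y hS c hac hc => sSup_le fun s hs => hS s hs c hac hc,
    fun x S hS => mem_ratherPairs_sSup hL hS⟩
  have hr : frameCoprod.inr L L a ≤ U := frameCoprod.inr_le_iff.2 fun c hac hc => by
    rw [sup_eq_left.2 hac] at hc
    exact _root_.le_ratherInterior (w := ⊥) (inf_bot_eq _) (by rw [bot_sup_eq, hc])
  have hd : codiagonalKernel L ≤ U := fun p hp c _ hc =>
    _root_.le_ratherInterior (mem_codiagonalKernel.1 hp) (by rw [sup_comm]; exact hc)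
  have hl : frameCoprod.inl L L a ≤ U :=
    le_sup_left.trans ((h.sup_codiagonalKernel a).le.trans (sup_le hr hd))
  exact frameCoprod.inl_le_iff.1 hl a le_rfl (sup_top_eq _)

/-- The point of a locale given by a prime element. -/
def FramePoint.ofPrime (m : L) (hm : m ≠ ⊤) (h : ∀ x y, x ⊓ y ≤ m → x ≤ m ∨ y ≤ m) :
    FramePoint L where
  toFun x := {_t | ¬ x ≤ m}
  map_inf' x y := by
    ext
    constructor
    · exact fun hxy => ⟨fun hx => hxy (inf_le_of_left_le hx), fun hy => hxy (inf_le_of_right_le hy)⟩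
    · rintro ⟨hx, hy⟩ hxy
      exact (h x y hxy).elim hx hy
  map_top' := by
    ext
    simpa using hm
  map_sSup' S := by
    ext
    simp

lemma FramePoint.mem_ofPrime {m : L} {hm : m ≠ ⊤} {h : ∀ x y, x ⊓ y ≤ m → x ≤ m ∨ y ≤ m} {x : L}
    {t : PUnit} : t ∈ FramePoint.ofPrime m hm h x ↔ ¬ x ≤ m := Iff.rfl

/-- If `a` is not below `b`, regularity gives `w` covering together with `a` but not with `b`. A
coatom above `w ⊔ b`, available by compactness, is prime, and its point lies in `a` but not in `b`.
-/
lemma DisjointSeparated.frameSpatial (h : DisjointSeparated L) (hL : FrameCompact L) :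
    FrameSpatial L := by
  intro a b hab
  by_contra hle
  obtain ⟨w, hwa, hwb⟩ : ∃ w, w ⊔ a = ⊤ ∧ w ⊔ b ≠ ⊤ := by
    by_contra! hw
    refine hle ((h.le_ratherInterior hL a).trans (sSup_le ?_))
    rintro z ⟨w, hzw, hwa⟩
    have := hw w hwa
    calc z = z ⊓ (w ⊔ b) := by rw [this, inf_top_eq]
      _ = z ⊓ b := by rw [inf_sup_left, hzw, bot_sup_eq]
      _ ≤ b := inf_le_right
  have : IsCoatomic L := CompleteLattice.coatomic_of_top_compact <| by
    rw [CompleteLattice.isCompactElement_iff_exists_le_sSup_of_le_sSup]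
    intro S hS
    obtain ⟨F, hF, hfin, hF'⟩ := hL S (top_unique hS)
    exact ⟨hfin.toFinset, by simpa using hF, by simp [Finset.sup_id_eq_sSup, hF']⟩
  obtain hb | ⟨m, hm, hbm⟩ := eq_top_or_exists_le_coatom (w ⊔ b)
  · exact hwb hb
  have hprime : ∀ x y, x ⊓ y ≤ m → x ≤ m ∨ y ≤ m := by
    intro x y hxy
    by_contra! hn
    have hx : m ⊔ x = ⊤ := hm.2 _ (left_lt_sup.2 hn.1)
    have hy : m ⊔ y = ⊤ := hm.2 _ (left_lt_sup.2 hn.2)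
    apply hm.1
    rw [← sup_eq_left.2 hxy, sup_inf_left, hx, hy, inf_top_eq]
  refine hab (FramePoint.ofPrime m hm.1 hprime) (a := PUnit.unit)
    (FramePoint.mem_ofPrime.2 fun ham => hm.1 (top_unique ?_)) (le_sup_right.trans hbm)
  rw [← hwa]
  exact sup_le (le_sup_left.trans hbm) ham

end

lemma disjointSeparated_point : DisjointSeparated (Set PUnit.{u + 1}) := by
  intro Q _ f g _
  ext s
  obtain rfl | rfl : s = ∅ ∨ s = Set.univ := s.eq_empty_or_nonempty.imp_right Set.Nonempty.eq_univ
  · exact (map_bot f).trans (map_bot g).symm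
  · exact (map_top f).trans (map_top g).symm

lemma frameCompact_point : FrameCompact (Set PUnit.{u + 1}) := fun A hA =>
  ⟨A, subset_rfl, Set.toFinite A, hA⟩

/-! ## Subframes -/

/-- A subframe is a subset closed under finite meets and arbitrary joins. -/
structure Subframe (X : Type u) [Order.Frame X] where
  /-- The underlying set. -/
  carrier : Set X
  top_mem : ⊤ ∈ carrier
  inf_mem : ∀ x ∈ carrier, ∀ y ∈ carrier, x ⊓ y ∈ carrier
  sSup_mem : ∀ S ⊆ carrier, sSup S ∈ carrier

namespace Subframe

variable {X : Type u} [Order.Frame X] (A : Subframe X)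

instance : SemilatticeInf A.carrier := Subtype.semilatticeInf fun {x y} hx hy => A.inf_mem x hx y hy

instance : SupSet A.carrier where
  sSup S := ⟨sSup (Subtype.val '' S), A.sSup_mem _ (by rintro _ ⟨x, -, rfl⟩; exact x.2)⟩

instance : OrderTop A.carrier := Subtype.orderTop A.top_mem

lemma coe_sSup (S : Set A.carrier) : ((sSup S : A.carrier) : X) = sSup (Subtype.val '' S) := rfl

lemma isLUB_sSup (S : Set A.carrier) : IsLUB S (sSup S) :=
  ⟨fun x hx => Subtype.coe_le_coe.1 (le_sSup (Set.mem_image_of_mem _ hx)), fun x hx =>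
    Subtype.coe_le_coe.1 (sSup_le (by rintro _ ⟨y, hy, rfl⟩; exact hx hy))⟩

instance : CompleteLattice A.carrier where
  __ := (inferInstance : SemilatticeInf A.carrier)
  __ := (inferInstance : OrderTop A.carrier)
  __ := completeLatticeOfSup A.carrier A.isLUB_sSup

instance : Order.Frame A.carrier :=
  Order.Frame.ofMinimalAxioms
    { (inferInstance : CompleteLattice A.carrier) with
      inf_sSup_le_iSup_inf := fun a S => by
        rw [← Subtype.coe_le_coe]
        change a.1 ⊓ sSup (Subtype.val '' S) ≤ _
        rw [inf_sSup_eq]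
        refine iSup₂_le ?_
        rintro _ ⟨b, hb, rfl⟩
        exact Subtype.coe_le_coe.2 (le_iSup₂_of_le (f := fun b (_ : b ∈ S) => a ⊓ b) b hb le_rfl) }

/-- The inclusion of a subframe. -/
def incl : FrameHom A.carrier X where
  toFun := Subtype.val
  map_inf' _ _ := rfl
  map_top' := rfl
  map_sSup' _ := rfl

/-- A frame homomorphism with values in a subframe. -/
def codRestrict {Y : Type u} [Order.Frame Y] (f : FrameHom Y X) (h : ∀ y, f y ∈ A.carrier) :
    FrameHom Y A.carrier where
  toFun y := ⟨f y, h y⟩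
  map_inf' x y := Subtype.ext (map_inf f x y)
  map_top' := Subtype.ext (map_top f)
  map_sSup' S := Subtype.ext ((map_sSup f S).trans (by rw [coe_sSup, ← Set.image_comp]; rfl))

/-- The range of a frame homomorphism. -/
def range {Y : Type u} [Order.Frame Y] (f : FrameHom Y X) : Subframe X where
  carrier := Set.range f
  top_mem := ⟨⊤, map_top f⟩
  inf_mem := by
    rintro _ ⟨x, rfl⟩ _ ⟨y, rfl⟩
    exact ⟨x ⊓ y, map_inf f x y⟩
  sSup_mem S hS := by
    refine ⟨sSup (f ⁻¹' S), (map_sSup f _).trans ?_⟩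
    rw [Set.image_preimage_eq_of_subset hS]

/-- The corestriction of a frame homomorphism to its range. -/
def rangeRestrict {Y : Type u} [Order.Frame Y] (f : FrameHom Y X) :
    FrameHom Y (range f).carrier :=
  (range f).codRestrict f fun y => ⟨y, rfl⟩

lemma rangeRestrict_surjective {Y : Type u} [Order.Frame Y] (f : FrameHom Y X) :
    Function.Surjective (rangeRestrict f) := by
  rintro ⟨_, y, rfl⟩
  exact ⟨y, rfl⟩

lemma rangeRestrict_eq_iff {Y : Type u} [Order.Frame Y] {f : FrameHom Y X} {x y : Y} :
    rangeRestrict f x = rangeRestrict f y ↔ f x = f y :=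
  Subtype.ext_iff

lemma frameCompact (hX : FrameCompact X) : FrameCompact A.carrier := by
  intro S hS
  obtain ⟨F, hF, hfin, hF'⟩ := hX (Subtype.val '' S) (congrArg Subtype.val hS)
  obtain ⟨G, hG, rfl⟩ := Set.subset_image_iff.1 hF
  exact ⟨G, hG, hfin.of_finite_image Subtype.val_injective.injOn, Subtype.ext hF'⟩

/-- The subframe generated by a family of subframes. -/
def sSupSubframe (𝒜 : Set (Subframe X)) : Subframe X where
  carrier := {x | ∀ T : Subframe X, (∀ A ∈ 𝒜, A.carrier ⊆ T.carrier) → x ∈ T.carrier}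
  top_mem T _ := T.top_mem
  inf_mem x hx y hy T hT := T.inf_mem x (hx T hT) y (hy T hT)
  sSup_mem S hS T hT := T.sSup_mem S fun _ hx => hS hx T hT

lemma le_sSupSubframe {𝒜 : Set (Subframe X)} {A : Subframe X} (hA : A ∈ 𝒜) :
    A.carrier ⊆ (sSupSubframe 𝒜).carrier :=
  fun _ hx _ hT => hT A hA hx

/-- The elements on which `f` and `g` agree form a subframe containing every member of the family.
-/
lemma disjointSeparated_sSupSubframe {𝒜 : Set (Subframe X)}
    (h : ∀ A ∈ 𝒜, DisjointSeparated A.carrier) :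
    DisjointSeparated (sSupSubframe 𝒜).carrier := by
  intro Q _ f g hfg
  let T : Subframe X :=
    { carrier := {x | ∃ hx : x ∈ (sSupSubframe 𝒜).carrier, f ⟨x, hx⟩ = g ⟨x, hx⟩}
      top_mem := ⟨(sSupSubframe 𝒜).top_mem, (map_top f).trans (map_top g).symm⟩
      inf_mem := by
        rintro x ⟨hx, hx'⟩ y ⟨hy, hy'⟩
        let x' : (sSupSubframe 𝒜).carrier := ⟨x, hx⟩
        let y' : (sSupSubframe 𝒜).carrier := ⟨y, hy⟩
        refine ⟨(sSupSubframe 𝒜).inf_mem x hx y hy, (map_inf f x' y').trans ?_⟩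
        exact (congrArg₂ (· ⊓ ·) hx' hy').trans (map_inf g x' y').symm
      sSup_mem := by
        intro S hS
        have hS' : S ⊆ (sSupSubframe 𝒜).carrier := fun x hx => (hS hx).1
        refine ⟨(sSupSubframe 𝒜).sSup_mem S hS', ?_⟩
        have : (⟨sSup S, (sSupSubframe 𝒜).sSup_mem S hS'⟩ : (sSupSubframe 𝒜).carrier) =
            sSup (Subtype.val ⁻¹' S) := Subtype.ext <| by
          rw [coe_sSup, Subtype.image_preimage_coe, Set.inter_eq_right.2 hS']
        rw [this, map_sSup, map_sSup]
        congr 1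
        refine Set.image_congr ?_
        rintro ⟨x, hx⟩ hxS
        exact (hS hxS).2 }
  ext ⟨x, hx⟩
  refine (hx T fun A hA a ha => ⟨le_sSupSubframe hA ha, ?_⟩).2
  let i : FrameHom A.carrier (sSupSubframe 𝒜).carrier :=
    (sSupSubframe 𝒜).codRestrict A.incl fun y => le_sSupSubframe hA y.2
  have := h A hA Q (f.comp i) (g.comp i) fun x y hxy =>
    hfg _ _ ((map_inf i x y).symm.trans ((congrArg i hxy).trans (map_bot i)))
  exact DFunLike.congr_fun this ⟨a, ha⟩

end Subframe

namespace FrameHom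

/-- The evaluation homomorphism of a product of frames. -/
def piEval {ι : Type*} (X : ι → Type*) [∀ i, Order.Frame (X i)] (i : ι) :
    FrameHom (∀ i, X i) (X i) where
  toFun x := x i
  map_inf' _ _ := rfl
  map_top' := rfl
  map_sSup' S := by rw [sSup_apply, sSup_image']

/-- The homomorphism to a product of frames with given components. -/
def piLift {ι : Type*} {X : ι → Type*} [∀ i, Order.Frame (X i)] {Y : Type*} [Order.Frame Y]
    (f : ∀ i, FrameHom Y (X i)) : FrameHom Y (∀ i, X i) where
  toFun y i := f i y
  map_inf' x y := funext fun i => map_inf (f i) x y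
  map_top' := funext fun i => map_top (f i)
  map_sSup' S := funext fun i => by
    rw [map_sSup, sSup_apply_eq_sSup_image, ← Set.image_comp]
    rfl

/-- Factorization of a frame homomorphism through a surjective one. -/
lemma exists_comp_eq_of_surjective {X Y Z : Type*} [Order.Frame X] [Order.Frame Y] [Order.Frame Z]
    (e : FrameHom X Y) (he : Function.Surjective e) (f : FrameHom X Z)
    (h : ∀ a b, e a = e b → f a = f b) : ∃ g : FrameHom Y Z, g.comp e = f := by
  have hs : ∀ y, e (Function.surjInv he y) = y := Function.surjInv_eq he
  have key : ∀ x, f (Function.surjInv he (e x)) = f x := fun x => h _ _ (hs _)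
  refine ⟨{ toFun := fun y => f (Function.surjInv he y)
            map_inf' := fun x y => ?_
            map_top' := ?_
            map_sSup' := fun S => ?_ }, FrameHom.ext key⟩
  · rw [← map_inf]
    exact h _ _ (by rw [hs, map_inf, hs, hs])
  · exact (h _ _ (by rw [hs, map_top])).trans (map_top f)
  · have : S = e '' (Function.surjInv he '' S) := by
      rw [← Set.image_comp]
      exact (Set.image_id S).symm.trans (Set.image_congr fun y _ => (hs y).symm)
    refine (h _ (sSup (Function.surjInv he '' S)) ?_).trans ?_
    · rw [hs, map_sSup, ← this]
    · rw [map_sSup, ← Set.image_comp]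
      rfl

end FrameHom

/-! ## The category of strongly Hausdorff locales -/

namespace HLoc

/-- The frame of opens of a strongly Hausdorff locale. -/
def Opens (X : HLoc.{u}) : Type u := X.obj

instance (X : HLoc.{u}) : Order.Frame X.Opens := inferInstanceAs (Order.Frame X.obj)

lemma disjointSeparated (X : HLoc.{u}) : DisjointSeparated X.Opens :=
  X.property.disjointSeparated

/-- The strongly Hausdorff locale of a disjointness separated frame. -/
def of (X : Type u) [Order.Frame X] (h : DisjointSeparated X) : HLoc.{u} :=
  ⟨Locale.of X, Locale.isStronglyHausdorff_of_disjointSeparated h⟩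

/-- The frame homomorphism of a morphism of strongly Hausdorff locales. -/
def frameHom {X Y : HLoc.{u}} (f : X ⟶ Y) : FrameHom Y.Opens X.Opens :=
  Locale.frameHom f.hom

/-- The morphism of strongly Hausdorff locales of a frame homomorphism. -/
def homOf {X Y : HLoc.{u}} (h : FrameHom Y.Opens X.Opens) : X ⟶ Y :=
  ObjectProperty.homMk (Locale.homOf h)

lemma frameHom_comp_apply {X Y Z : HLoc.{u}} (f : X ⟶ Y) (g : Y ⟶ Z) (z : Z.Opens) :
    frameHom (f ≫ g) z = frameHom f (frameHom g z) := rfl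

lemma hom_ext_frameHom {X Y : HLoc.{u}} {f g : X ⟶ Y} (h : frameHom f = frameHom g) : f = g :=
  ObjectProperty.hom_ext _ (Locale.hom_ext_frameHom h)

lemma mono_of_surjective {X Y : HLoc.{u}} (f : X ⟶ Y) (hf : Function.Surjective (frameHom f)) :
    Mono f := ⟨fun g h hgh => hom_ext_frameHom <| FrameHom.ext fun x => by
  obtain ⟨y, rfl⟩ := hf x
  rw [← frameHom_comp_apply, hgh, frameHom_comp_apply]⟩

section Colimits

variable {J : Type u} [Category.{u} J] (D : J ⥤ HLoc.{u})

/-- The limit of a diagram of frames, as a subframe of the product. -/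
def compatible : Subframe (∀ j, (D.obj j).Opens) where
  carrier := {x | ∀ ⦃i j : J⦄ (φ : i ⟶ j), frameHom (D.map φ) (x j) = x i}
  top_mem _ _ _ := map_top _
  inf_mem x hx y hy i j φ := (map_inf (frameHom (D.map φ)) _ _).trans (by rw [hx, hy]; rfl)
  sSup_mem S hS i j φ := by
    rw [sSup_apply, sSup_apply, map_iSup]
    exact iSup_congr fun x => hS x.2 φ

/-- The largest strongly Hausdorff quotient of the colimit of a diagram of locales. -/
def colimitSubframe : Subframe (∀ j, (D.obj j).Opens) :=
  Subframe.sSupSubframe {A | A.carrier ⊆ (compatible D).carrier ∧ DisjointSeparated A.carrier}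

lemma colimitSubframe_le : (colimitSubframe D).carrier ⊆ (compatible D).carrier :=
  fun _ hx => hx _ fun _ hA => hA.1

/-- The colimit of a diagram of strongly Hausdorff locales. -/
def colimitObj : HLoc.{u} :=
  of (colimitSubframe D).carrier (Subframe.disjointSeparated_sSupSubframe fun _ hA => hA.2)

/-- The colimit cocone of a diagram of strongly Hausdorff locales. -/
def colimitCocone : Cocone D where
  pt := colimitObj D
  ι :=
    { app j := homOf (Y := colimitObj D)
        ((FrameHom.piEval (fun j => (D.obj j).Opens) j).comp (colimitSubframe D).incl)
      naturality _ _ φ := hom_ext_frameHom <| FrameHom.ext fun x =>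
        colimitSubframe_le D x.2 φ }

/-- The range is a frame quotient of the opens of `s.pt`, hence one of the subframes generating
`colimitSubframe`. -/
lemma range_piLift_le (s : Cocone D) :
    (Subframe.range (FrameHom.piLift fun j => frameHom (s.ι.app j))).carrier ⊆
      (colimitSubframe D).carrier := by
  refine Subframe.le_sSupSubframe ⟨?_, ?_⟩
  · rintro _ ⟨y, rfl⟩ i j φ
    exact congrArg (frameHom · y) (s.w φ)
  · exact s.pt.disjointSeparated.of_surjective _ (Subframe.rangeRestrict_surjective _)

/-- The universal property of the colimit cocone. -/
def colimitCoconeIsColimit : IsColimit (colimitCocone D) where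
  desc s := homOf (X := colimitObj D) ((colimitSubframe D).codRestrict
    (FrameHom.piLift fun j => frameHom (s.ι.app j)) fun y => range_piLift_le D s ⟨y, rfl⟩)
  fac _ _ := hom_ext_frameHom (FrameHom.ext fun _ => rfl)
  uniq _ _ hm := hom_ext_frameHom <| FrameHom.ext fun y => Subtype.ext <| funext fun j =>
    congrArg (frameHom · y) (hm j)

instance : HasColimitsOfSize.{u, u} HLoc.{u} where
  has_colimits_of_shape _ _ :=
    { has_colimit := fun D => ⟨⟨⟨colimitCocone D, colimitCoconeIsColimit D⟩⟩⟩ }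

end Colimits

end HLoc

namespace KHLoc

lemma frameCompact (K : KHLoc.{u}) : FrameCompact K.obj.Opens := K.property

lemma frameSpatial (K : KHLoc.{u}) : FrameSpatial K.obj.Opens :=
  K.obj.disjointSeparated.frameSpatial K.frameCompact

/-- The compact strongly Hausdorff locale of a compact disjointness separated frame. -/
def of (X : Type u) [Order.Frame X] (h : DisjointSeparated X) (hX : FrameCompact X) : KHLoc.{u} :=
  ⟨HLoc.of X h, hX⟩

/-- The one-point locale. -/
def point : KHLoc.{u} := of (Set PUnit.{u + 1}) disjointSeparated_point frameCompact_point

/-! ### The diagram of compact locales over a locale is essentially small -/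

section FinallySmall

variable {L : HLoc.{u}}

variable (L) in
/-- The compact sublocales among the compact locales over `L`. -/
def isSublocale : ObjectProperty (CostructuredArrow incl L) :=
  fun σ => Function.Surjective (HLoc.frameHom σ.hom)

lemma isSublocale.eq_of_hom {X Y : CostructuredArrow incl L} (hY : isSublocale L Y)
    (f g : X ⟶ Y) : f = g := by
  have := HLoc.mono_of_surjective Y.hom hY
  refine CostructuredArrow.hom_ext _ _ (ObjectProperty.hom_ext _ ?_)
  exact (cancel_mono Y.hom).1 ((CostructuredArrow.w f).trans (CostructuredArrow.w g).symm)

lemma isSublocale.nonempty_hom {X Y : CostructuredArrow incl L} (hY : isSublocale L Y)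
    (h : ∀ a b, HLoc.frameHom Y.hom a = HLoc.frameHom Y.hom b →
      HLoc.frameHom X.hom a = HLoc.frameHom X.hom b) : Nonempty (X ⟶ Y) := by
  obtain ⟨k, hk⟩ := FrameHom.exists_comp_eq_of_surjective _ hY (HLoc.frameHom X.hom) h
  let k' : X.left.obj ⟶ Y.left.obj := HLoc.homOf k
  exact ⟨CostructuredArrow.homMk (ObjectProperty.homMk k') (HLoc.hom_ext_frameHom hk)⟩

lemma eq_of_hom {X Y : CostructuredArrow incl L} (f : X ⟶ Y) {a b : L.Opens}
    (h : HLoc.frameHom Y.hom a = HLoc.frameHom Y.hom b) :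
    HLoc.frameHom X.hom a = HLoc.frameHom X.hom b := by
  rw [← CostructuredArrow.w f, HLoc.frameHom_comp_apply, HLoc.frameHom_comp_apply, h]

/-- A sublocale is determined up to isomorphism by its kernel relation on the opens of `L`, and such
relations form a small type. -/
instance : EssentiallySmall.{u} (isSublocale L).FullSubcategory := by
  rw [essentiallySmall_iff]
  refine ⟨?_, inferInstance⟩
  let F := fromSkeleton (isSublocale L).FullSubcategory
  let κ : Skeleton (isSublocale L).FullSubcategory → L.Opens → L.Opens → Prop := fun X a b =>
    HLoc.frameHom (F.obj X).obj.hom a = HLoc.frameHom (F.obj X).obj.hom b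
  refine small_of_injective (f := κ) fun X Y hXY => ?_
  have h : ∀ a b, κ X a b ↔ κ Y a b := fun a b => by rw [hXY]
  obtain ⟨f⟩ := (F.obj Y).property.nonempty_hom (X := (F.obj X).obj) fun a b => (h a b).2
  obtain ⟨g⟩ := (F.obj X).property.nonempty_hom (X := (F.obj Y).obj) fun a b => (h a b).1
  let e : F.obj X ≅ F.obj Y := ObjectProperty.isoMk _
    ⟨f, g, (F.obj X).property.eq_of_hom _ _, (F.obj Y).property.eq_of_hom _ _⟩
  exact skeleton_skeletal _ ⟨F.preimageIso e⟩

variable (L) in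
/-- The image of a compact locale over `L`. -/
def imageObj (σ : CostructuredArrow incl L) : KHLoc.{u} :=
  of (Subframe.range (HLoc.frameHom σ.hom)).carrier
    (L.disjointSeparated.of_surjective _ (Subframe.rangeRestrict_surjective _))
    (Subframe.frameCompact _ σ.left.frameCompact)

variable (L) in
/-- The image of a compact locale over `L`, as a sublocale of `L`. -/
def image (σ : CostructuredArrow incl L) : CostructuredArrow incl L :=
  CostructuredArrow.mk (Y := imageObj L σ)
    (HLoc.homOf (X := (imageObj L σ).obj) (Subframe.rangeRestrict (HLoc.frameHom σ.hom)))

lemma isSublocale_image (σ : CostructuredArrow incl L) : isSublocale L (image L σ) :=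
  Subframe.rangeRestrict_surjective (HLoc.frameHom σ.hom)

lemma image_eq_iff (σ : CostructuredArrow incl L) {a b : L.Opens} :
    HLoc.frameHom (image L σ).hom a = HLoc.frameHom (image L σ).hom b ↔
      HLoc.frameHom σ.hom a = HLoc.frameHom σ.hom b :=
  Subframe.rangeRestrict_eq_iff (f := HLoc.frameHom σ.hom)

/-- Any map from `σ` to a sublocale factors through the image of `σ`, so every object of the comma
category receives a map from `I`. -/
instance : (isSublocale L).ι.Final where
  out σ := by
    obtain ⟨i⟩ := (isSublocale_image σ).nonempty_hom (X := σ) fun a b => (image_eq_iff σ).1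
    let Z : (isSublocale L).FullSubcategory := ⟨image L σ, isSublocale_image σ⟩
    let I : StructuredArrow σ (isSublocale L).ι :=
      StructuredArrow.mk (Y := Z) (T := (isSublocale L).ι) i
    have hI : ∀ X : StructuredArrow σ (isSublocale L).ι, Nonempty (I ⟶ X) := fun X => by
      obtain ⟨f⟩ := X.right.property.nonempty_hom (X := image L σ) fun a b h =>
        (image_eq_iff σ).2 (eq_of_hom X.hom h)
      exact ⟨StructuredArrow.homMk (ObjectProperty.homMk f) (X.right.property.eq_of_hom _ _)⟩
    have : Nonempty (StructuredArrow σ (isSublocale L).ι) := ⟨I⟩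
    exact zigzag_isConnected fun X Y =>
      (Zigzag.of_inv (hI X).some).trans (Zigzag.of_hom (hI Y).some)

instance : FinallySmall.{u} (CostructuredArrow incl L) :=
  finallySmall_of_final_of_essentiallySmall (isSublocale L).ι

end FinallySmall

lemma hasPointwiseLeftKanExtension_incl :
    incl.{u}.HasPointwiseLeftKanExtension incl.{u} := fun L =>
  have : HasColimitsOfShape (CostructuredArrow incl L) HLoc.{u} :=
    hasColimitsOfShape_of_finallySmall.{u} _ _
  (inferInstance : HasColimit (KHLoc.over L))

/-! ### Maps from compact locales into `T L` -/

section Density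

open densityComonad

attribute [local instance] hasPointwiseLeftKanExtension_incl

variable {L : HLoc.{u}}

/-- The points of a locale are the maps from the one-point locale. -/
def pointHom {X : HLoc.{u}} (p : FramePoint X.Opens) : point.obj ⟶ X :=
  HLoc.homOf (X := point.obj) p

lemma hom_ext_point {K : KHLoc.{u}} {X : HLoc.{u}} {f g : K.obj ⟶ X}
    (h : ∀ p : point ⟶ K, incl.map p ≫ f = incl.map p ≫ g) : f = g := by
  have key : ∀ (f g : K.obj ⟶ X), (∀ p : point ⟶ K, incl.map p ≫ f = incl.map p ≫ g) →
      ∀ x, HLoc.frameHom f x ≤ HLoc.frameHom g x := fun f g h x =>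
    K.frameSpatial _ _ fun p => le_of_eq <| show p _ = p _ from
      congrArg (HLoc.frameHom · x) (h (ObjectProperty.homMk (pointHom p)))
  exact HLoc.hom_ext_frameHom <| FrameHom.ext fun x =>
    le_antisymm (key f g h x) (key g f (fun p => (h p).symm) x)

/-- The locale `T L` is covered by the points of `L`. -/
lemma eq_of_forall_point {a b : ((densityComonad incl).obj L).Opens}
    (h : ∀ q : point.obj ⟶ L, HLoc.frameHom (leg incl (a := point) q) a =
      HLoc.frameHom (leg incl (a := point) q) b) : a = b := by
  let T := (densityComonad incl).obj L
  let π : FrameHom T.Opens (∀ _ : point.obj ⟶ L, point.{u}.obj.Opens) :=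
    FrameHom.piLift fun q => HLoc.frameHom (leg incl (a := point) q)
  let e := Subframe.rangeRestrict π
  have he : Function.Surjective e := Subframe.rangeRestrict_surjective π
  -- `S` is the sublocale of `T` spanned by the points of `L`. Spatiality factors every coprojection
  -- through it, so its inclusion has a section and no opens are identified.
  let S : HLoc.{u} := HLoc.of (Subframe.range π).carrier (T.disjointSeparated.of_surjective e he)
  let j : S ⟶ T := HLoc.homOf (X := S) e
  have : Mono j := HLoc.mono_of_surjective j he
  have hleg : ∀ (K : KHLoc.{u}) (σ : K.obj ⟶ L), ∃ l : K.obj ⟶ S, l ≫ j = leg incl σ := by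
    intro K σ
    obtain ⟨k, hk⟩ := FrameHom.exists_comp_eq_of_surjective e he
      (HLoc.frameHom (leg incl σ)) fun x y hxy => by
        have hpt : ∀ p : FramePoint K.obj.Opens,
            p (HLoc.frameHom (leg incl σ) x) = p (HLoc.frameHom (leg incl σ) y) := fun p => by
          have h₁ := congrFun (Subframe.rangeRestrict_eq_iff.1 hxy) (pointHom p ≫ σ)
          have h₂ : pointHom p ≫ leg incl σ = leg incl (a := point) (pointHom p ≫ σ) :=
            map_leg (F := incl) (a := point) (b := K) (ObjectProperty.homMk (pointHom p)) σ
          change HLoc.frameHom (leg incl (a := point) (pointHom p ≫ σ)) x =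
            HLoc.frameHom (leg incl (a := point) (pointHom p ≫ σ)) y at h₁
          rwa [← h₂] at h₁
        exact le_antisymm (K.frameSpatial _ _ fun p => (hpt p).le)
          (K.frameSpatial _ _ fun p => (hpt p).ge)
    exact ⟨HLoc.homOf (Y := S) k, HLoc.hom_ext_frameHom hk⟩
  choose l hl using hleg
  let t : T ⟶ S := desc (F := incl) l fun K K' h σ => by
    rw [← cancel_mono j, Category.assoc]
    exact (congrArg (incl.map h ≫ ·) (hl K' σ)).trans
      ((map_leg h σ).trans (hl K _).symm)
  have ht : t ≫ j = 𝟙 T := hom_ext (F := incl) fun K σ => by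
    refine (Category.assoc _ _ _).symm.trans ?_
    refine (congrArg (· ≫ j) (leg_desc (F := incl) l _ σ)).trans ((hl K σ).trans ?_)
    exact (Category.comp_id _).symm
  have hab : e a = e b := Subframe.rangeRestrict_eq_iff.2 (funext h)
  have hx : ∀ x, HLoc.frameHom t (e x) = x := fun x => congrArg (HLoc.frameHom · x) ht
  rw [← hx a, ← hx b, hab]

lemma point_eq_bot_or_eq_top (s : point.{u}.obj.Opens) : s = ⊥ ∨ s = ⊤ :=
  (Set.eq_empty_or_nonempty (s : Set PUnit.{u + 1})).imp_right Set.Nonempty.eq_univ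

lemma point_bot_ne_top : (⊥ : point.{u}.obj.Opens) ≠ ⊤ :=
  (Set.empty_ne_univ : (∅ : Set PUnit.{u + 1}) ≠ Set.univ)

/-- Each point of `T L` comes from a point of `L`. -/
lemma point_eq_leg (p : point.obj ⟶ (densityComonad incl).obj L) :
    p = leg incl (a := point) (p ≫ counit incl L) := by
  let T := (densityComonad incl).obj L
  let m : T.Opens := sSup {z | HLoc.frameHom p z = ⊥}
  have hm : HLoc.frameHom p m = ⊥ := by
    rw [map_sSup, sSup_eq_bot]
    rintro _ ⟨z, hz, rfl⟩
    exact hz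
  obtain ⟨q, hq⟩ : ∃ q : point.obj ⟶ L, HLoc.frameHom (leg incl (a := point) q) m = ⊥ := by
    by_contra! hne
    have : m = ⊤ := eq_of_forall_point fun q =>
      ((point_eq_bot_or_eq_top _).resolve_left (hne q)).trans (map_top _).symm
    rw [this] at hm
    exact point_bot_ne_top (hm.symm.trans (map_top _))
  have hqp : leg incl (a := point) q = p := by
    let f : FrameHom T.Opens point.{u}.obj.Opens := HLoc.frameHom (leg incl (a := point) q)
    let g : FrameHom T.Opens point.{u}.obj.Opens := HLoc.frameHom p
    -- If `p` misses `x`, then `x ≤ m` and `q` misses it too; if `p` lies in `x`, it misses the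
    -- disjoint `y`.
    have hfg : f = g := T.disjointSeparated _ f g fun x y hxy => by
      obtain hx | hx := point_eq_bot_or_eq_top (g x)
      · have hxm : x ≤ m := le_sSup hx
        have : f x ≤ ⊥ := (OrderHomClass.mono f hxm).trans (le_of_eq hq)
        exact le_bot_iff.1 (inf_le_left.trans this)
      · have : g x ⊓ g y = ⊥ := by rw [← map_inf, hxy, map_bot]
        rw [hx, top_inf_eq] at this
        rw [this, inf_bot_eq]
    exact HLoc.hom_ext_frameHom hfg
  exact hqp.symm.trans (congrArg (leg incl) ((leg_counit (F := incl) (a := point) q).symm.trans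
    (congrArg (· ≫ counit incl L) hqp)))

/-- Spatiality of `K` reduces to points, which `point_eq_leg` recovers from their image in `L`. -/
lemma counitSeparates : CounitSeparates incl.{u} := fun K L f g hfg => by
  refine hom_ext_point fun p => ?_
  refine (point_eq_leg (incl.map p ≫ f)).trans (Eq.trans ?_ (point_eq_leg (incl.map p ≫ g)).symm)
  rw [Category.assoc, Category.assoc, hfg]

lemma isLeftKanExtendable_incl : IsLeftKanExtendable incl.{u} :=
  ⟨inferInstance, counitSeparates.isIso_δ⟩

end Density

end KHLoc

/-! ### Compactly generated locales and colimits of compact ones -/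

open densityComonad in
lemma HLoc.isCompactlyGenerated_of_iso_colimit [IsLeftKanExtendable KHLoc.incl.{u}]
    {L : HLoc.{u}} {𝒥 : Type w} [Category.{v} 𝒥] {F : 𝒥 ⥤ KHLoc.{u}}
    [HasColimit (F ⋙ KHLoc.incl)] (e : L ≅ colimit (F ⋙ KHLoc.incl)) :
    L.IsCompactlyGenerated := by
  obtain ⟨s, hs⟩ := exists_section_counit (colimit.isColimit (F ⋙ KHLoc.incl))
  have hs' : (e.hom ≫ s ≫ (densityComonad KHLoc.incl).map e.inv) ≫ counit KHLoc.incl L = 𝟙 L := by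
    rw [Category.assoc, Category.assoc, map_counit, reassoc_of% hs, e.hom_inv_id]
  exact ⟨KHLoc.counitSeparates.coalgebra hs', rfl⟩

open densityComonad in
lemma HLoc.IsCompactlyGenerated.nonempty_iso [IsLeftKanExtendable KHLoc.incl.{u}]
    {L : HLoc.{u}} [HasColimit (KHLoc.over L)] (h : L.IsCompactlyGenerated) :
    Nonempty (L ≅ colimit (KHLoc.over L)) := by
  obtain ⟨A, rfl⟩ := h
  have := KHLoc.counitSeparates.isIso_counit A
  exact ⟨(asIso (counit KHLoc.incl A.A)).symm⟩

end
theorem mainTheorem9 :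
    -- `KHLoc` is left Kan-extendable in `HLoc`, so that `kHLoc` is defined
    ∃ _ : IsLeftKanExtendable KHLoc.incl.{u},
      -- `kHLoc` is a full subcategory of `HLoc`
      (kHLoc.incl.{u}.Full ∧ kHLoc.incl.{u}.Faithful ∧ Function.Injective kHLoc.incl.{u}.obj) ∧
      -- it is coreflective, with coreflector `T` and with `T(L) ≅ colim J_L`
      (∃ c : Coreflective kHLoc.incl.{u},
        (∃ φ : c.R ⋙ kHLoc.incl ≅ (densityComonad KHLoc.incl.{u}).toFunctor,
          φ.hom ≫ (densityComonad KHLoc.incl.{u}).ε = c.adj.counit) ∧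
        ∀ L : HLoc.{u}, ∃ _ : HasColimit (KHLoc.over L),
          ∃ ψ : kHLoc.incl.obj (c.R.obj L) ≅ colimit (KHLoc.over L),
            ∀ σ : CostructuredArrow KHLoc.incl L,
              colimit.ι (KHLoc.over L) σ ≫ ψ.inv ≫ c.adj.counit.app L = σ.hom) ∧
      -- the compactly generated objects are the (small) colimits of compact ones
      (∀ L : HLoc.{u}, L.IsCompactlyGenerated ↔
        ∃ (𝒥 : Type u) (_ : Category.{u} 𝒥) (F : 𝒥 ⥤ KHLoc.{u})
          (_ : HasColimit (F ⋙ KHLoc.incl)), Nonempty (L ≅ colimit (F ⋙ KHLoc.incl))) ∧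
      -- colimits of diagrams of any size, if they exist, are compactly generated
      (∀ (L : HLoc.{u}) (𝒥 : Type w) [Category.{v} 𝒥] (F : 𝒥 ⥤ KHLoc.{u})
        [HasColimit (F ⋙ KHLoc.incl)],
        Nonempty (L ≅ colimit (F ⋙ KHLoc.incl)) → L.IsCompactlyGenerated) := by
  have := KHLoc.isLeftKanExtendable_incl.{u}
  have hcolim : ∀ L : HLoc.{u}, HasColimit (KHLoc.over L) :=
    KHLoc.hasPointwiseLeftKanExtension_incl
  have hfull : kHLoc.incl.{u}.Full := KHLoc.counitSeparates.full_forget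
  refine ⟨inferInstance, ⟨hfull, inferInstance, KHLoc.counitSeparates.forget_obj_injective⟩,
    ⟨{ R := (densityComonad KHLoc.incl.{u}).cofree
       adj := (densityComonad KHLoc.incl.{u}).adj }, ⟨Iso.refl _, ?_⟩, fun L => ?_⟩,
    fun L => ⟨fun h => ?_, ?_⟩, fun L 𝒥 _ F _ ⟨e⟩ => HLoc.isCompactlyGenerated_of_iso_colimit e⟩
  · exact (Category.id_comp _).trans (Comonad.adj_counit (densityComonad KHLoc.incl.{u})).symm
  · refine ⟨inferInstance, Iso.refl _, fun σ => ?_⟩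
    refine (congrArg (colimit.ι (KHLoc.over L) σ ≫ ·) ((Category.id_comp _).trans
      (NatTrans.congr_app (Comonad.adj_counit (densityComonad KHLoc.incl.{u})) L))).trans ?_
    exact densityComonad.leg_counit (F := KHLoc.incl) (a := σ.left) σ.hom
  · obtain ⟨e⟩ := h.nonempty_iso
    -- Finality replaces the large index category by a small one without changing the colimit.
    let G := fromFinalModel.{u} (CostructuredArrow KHLoc.incl L)
    have : HasColimit (G ⋙ KHLoc.over L) := inferInstance
    exact ⟨_, inferInstance, G ⋙ CostructuredArrow.proj KHLoc.incl L, this,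
      ⟨e ≪≫ (Functor.Final.colimitIso G (KHLoc.over L)).symm⟩⟩
  · rintro ⟨𝒥, _, F, _, ⟨e⟩⟩
    exact HLoc.isCompactlyGenerated_of_iso_colimit e
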